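/- Let $d\ge 1$ and let $E_d$ be the set of nearest-neighbour edges of $\mathbb Z^d$. An environment is a nonnegative, locally integrable function $\eta:\mathbb R\times E_d\to[0,\infty)$, $(t,e)\mapsto \eta_t(e)$, modulo a.e. equality (locally integrable: $\int_a^b\eta_t(e)\,dt<\infty$ for all $a<b$ and $e\in E_d$); the space of environments carries the Borel $\sigma$-algebra of the local $L^1$ topology. A random environment is stationary if for all $x\in\mathbb Z^d$, $t\in\mathbb R$ the shifted environment $(\eta_{s-t}(e-x))_{s,e}$ has the same law as $\eta$. For an environment $\eta$, the (doubly infinite) random walk in $\eta$ started at $u$ at time $s$ is the càdlàg process $(X_t)_{t\in\mathbb R}$ with values in $\mathbb Z^d\cup\{\infty\}$ (the point $\infty$ accounting for explosion) and $X_s=u$, whose evolutions after and before time $s$ are independent, such that $(X_t)_{t\ge s}$ is the continuous-time Markov chain with time-dependent generator $\mathcal L^\eta_tf(x)=\sum_{y\sim x}\eta_t(\{x,y\})(f(y)-f(x))$ and, backwards in time, $(X_{-t})_{t\ge -s}$ is (up to the càdlàg convention at jump times) the Markov chain with the generator of the time-reversed environment $(\eta_{-t}(e))_{t,e}$, started at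 $u$ at time $-s$. The environment $\eta$ is non-explosive if for all $u$ and $s$ this walk a.s. makes only finitely many jumps in every bounded time interval. Let $\eta$ be a stationary random environment on $\mathbb Z^d$ that is almost surely non-explosive, and let $(X_t)_{t\in\mathbb R}$ and $(Y_t)_{t\in\mathbb R}$ be random walks in $\eta$, both started at the origin at time zero, that are conditionally independent given $\eta$. Write $\mathbb E^\eta$ for conditional expectation given $\eta$. If $$\mathbb E^\eta\Big[\sum_{n\ge 0}\mathbf 1\{X_{-n}=Y_{-n}\}\Big]=\infty\quad\text{almost surely},$$ then $$\sum_{n\ge 0}\mathbf 1\{X_n=Y_n\}=\infty\quad\text{almost surely}.$$ -/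

import Mathlib

open MeasureTheory ProbabilityTheory Set Filter Topology
open scoped ENNReal

noncomputable section

/-- The Euclidean lattice `ℤ^d` with its nearest-neighbour graph structure: `x ∼ y` iff
`‖x - y‖₁ = 1`. Its edge set (a set of unordered pairs) is `E_d`. -/
def latticeGraph (d : ℕ) : SimpleGraph (Fin d → ℤ) where
  Adj x y := ∑ i, |x i - y i| = 1
  symm := ⟨fun x y h => by simpa only [abs_sub_comm] using h⟩
  loopless := ⟨fun x h => by simp at h⟩

/-- The type `E_d` of edges of `ℤ^d`. -/
abbrev LatticeEdge (d : ℕ) : Type := (latticeGraph d).edgeSet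

/-- The translated edge `e - x = {a - x, b - x}` of `e = {a, b}`. -/
def LatticeEdge.sub {d : ℕ} (e : LatticeEdge d) (x : Fin d → ℤ) : LatticeEdge d :=
  ⟨Sym2.map (fun a => a - x) e.1, by
    obtain ⟨e, he⟩ := e
    induction e using Sym2.ind with
    | _ a b =>
      have h : ∑ i, |a i - b i| = 1 := he
      change ∑ i, |(a - x) i - (b - x) i| = 1
      simpa using h⟩

/-- An environment: a family of nonnegative, locally integrable functions of time, one for each edge
of `ℤ^d`, taken modulo almost everywhere equality. -/
@[ext]
structure Environment (d : ℕ) where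
  /-- the conductances, as functions of time modulo a.e. equality -/
  cond : LatticeEdge d → (ℝ →ₘ[(volume : Measure ℝ)] ℝ)
  nonneg : ∀ e, 0 ≤ cond e
  locallyIntegrable : ∀ e, LocallyIntegrable (cond e) (volume : Measure ℝ)

/-- Helper: local integrability is preserved by measure-preserving homeomorphisms. -/
theorem locallyIntegrable_compMeasurePreserving (f : ℝ →ₘ[(volume : Measure ℝ)] ℝ)
    (hf : LocallyIntegrable f (volume : Measure ℝ)) (φ : ℝ ≃ₜ ℝ)
    (hφ : MeasurePreserving φ (volume : Measure ℝ) volume) :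
    LocallyIntegrable (f.compMeasurePreserving φ hφ) (volume : Measure ℝ) := by
  have h1 : LocallyIntegrable (f ∘ φ) (volume : Measure ℝ) := by
    rw [← locallyIntegrable_map_homeomorph, hφ.map_eq]
    exact hf
  have h2 := f.coeFn_compMeasurePreserving hφ
  intro x
  obtain ⟨U, hU, hUi⟩ := h1 x
  exact ⟨U, hU, hUi.congr_fun_ae (ae_restrict_of_ae h2.symm)⟩

/-- Helper: order preservation under composition with measure-preserving maps. -/
theorem nonneg_compMeasurePreserving (f : ℝ →ₘ[(volume : Measure ℝ)] ℝ) (hf : 0 ≤ f)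
    (φ : ℝ → ℝ) (hφ : MeasurePreserving φ (volume : Measure ℝ) volume) :
    0 ≤ f.compMeasurePreserving φ hφ := by
  rw [← AEEqFun.coeFn_le] at hf ⊢
  have h1 := hφ.quasiMeasurePreserving.ae hf
  have h0 := hφ.quasiMeasurePreserving.ae
    (AEEqFun.coeFn_zero (α := ℝ) (β := ℝ) (μ := (volume : Measure ℝ)))
  filter_upwards [h1, h0, f.coeFn_compMeasurePreserving hφ,
    AEEqFun.coeFn_zero (α := ℝ) (β := ℝ) (μ := (volume : Measure ℝ))] with t h1 h0 h2 h3
  rw [h3, h2]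
  rw [h0] at h1
  exact h1

namespace Environment

variable {d : ℕ}

/-- The restriction of the conductance of the edge `e` to the time interval `[a, b]`, as an element
of `L¹([a, b])`. -/
def toL1 (e : LatticeEdge d) (a b : ℝ) (η : Environment d) :
    Lp ℝ 1 ((volume : Measure ℝ).restrict (Icc a b)) :=
  Integrable.toL1 (η.cond e)
    ((η.locallyIntegrable e).integrableOn_isCompact (isCompact_Icc (a := a) (b := b)))

/-- The local `L¹` topology: `ηⁿ → η` iff `∫_a^b |ηⁿ_t(e) - η_t(e)| dt → 0` for all `e`, `a < b`. -/
instance : TopologicalSpace (Environment d) :=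
  ⨅ (e : LatticeEdge d) (a : ℝ) (b : ℝ), TopologicalSpace.induced (toL1 e a b) inferInstance

/-- The space of environments carries the Borel σ-algebra of the local `L¹` topology. -/
instance : MeasurableSpace (Environment d) := borel _

instance : BorelSpace (Environment d) := ⟨rfl⟩

/-- The space-time shift `(τ_{x,t} η)_s(e) = η_{s-t}(e - x)`. -/
def shift (x : Fin d → ℤ) (t : ℝ) (η : Environment d) : Environment d where
  cond e := (η.cond (e.sub x)).compMeasurePreserving (fun s => s - t)
    (measurePreserving_sub_right volume t)
  nonneg _ := nonneg_compMeasurePreserving _ (η.nonneg _) _ _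
  locallyIntegrable _ := locallyIntegrable_compMeasurePreserving _ (η.locallyIntegrable _)
    (Homeomorph.subRight t) _

/-- The time reversal `(R η)_s(e) = η_{-s}(e)`. -/
def reverse (η : Environment d) : Environment d where
  cond e := (η.cond e).compMeasurePreserving (fun s => -s) (Measure.measurePreserving_neg volume)
  nonneg _ := nonneg_compMeasurePreserving _ (η.nonneg _) _ _
  locallyIntegrable _ := locallyIntegrable_compMeasurePreserving _ (η.locallyIntegrable _)
    (Homeomorph.neg ℝ) _

open Classical in
/-- The jump rate `η_t({x, y})` from `x` to `y` at time `t`, equal to zero if `x`, `y` are not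
neighbours. (It depends on a choice of representative of the a.e. class, but is only ever used
under an integral over time.) -/
def rate (η : Environment d) (x y : Fin d → ℤ) (t : ℝ) : ℝ≥0∞ :=
  if h : (latticeGraph d).Adj x y then ENNReal.ofReal (η.cond ⟨s(x, y), h⟩ t) else 0

/-- The total conductance `η_t(x) = ∑_{y ∼ x} η_t({x, y})`. -/
def exitRate (η : Environment d) (x : Fin d → ℤ) (t : ℝ) : ℝ≥0∞ := ∑' y, η.rate x y t

/-- The probability `exp (-∫_s^t η_r(x) dr)` that a walk which is at `x` at time `s` makes no jump
during `(s, t]`. -/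
def stayProb (η : Environment d) (x : Fin d → ℤ) (s t : ℝ) : ℝ≥0∞ :=
  ENNReal.ofReal (Real.exp (-(∫⁻ r in Ioc s t, η.exitRate x r).toReal))

/-- For `s ≤ t`, `η.jumpProb n s t u v` is the probability that the continuous-time Markov chain
with generator `(L_r f)(x) = ∑_{y ∼ x} η_r({x, y}) (f y - f x)`, started at `u` at time `s`, makes
exactly `n` jumps during `(s, t]` and is at `v` at time `t`. The recursion is a decomposition
according to the time `r` of the first jump and the position `w` just after it. -/
def jumpProb (η : Environment d) :
    ℕ → ℝ → ℝ → (Fin d → ℤ) → (Fin d → ℤ) → ℝ≥0∞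
  | 0, s, t, u, v => Set.indicator {v} (fun _ => η.stayProb u s t) u
  | n + 1, s, t, u, v =>
      ∫⁻ r in Ioc s t, η.stayProb u s r * ∑' w, η.rate u w r * jumpProb η n r t w v

/-- The transition probability `P^η_{s,t}(u, v)`: the probability that the walk in `η` which is at
`u` at time `s` is at `v` at time `t`, having made finitely many jumps in between. This is the
minimal transition function of the generator `L`. Walks are doubly infinite, so `t < s` is allowed:
backwards in time the walk from `(u, s)` is a walk in the reversed environment from `(u, -s)`. -/
def transProb (η : Environment d) (s t : ℝ) (u v : Fin d → ℤ) : ℝ≥0∞ :=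
  if s ≤ t then ∑' n, η.jumpProb n s t u v else ∑' n, η.reverse.jumpProb n (-s) (-t) u v

/-- An environment is non-explosive if, from every starting space-time location `(u, s)`, the walk
almost surely makes only finitely many jumps in every bounded time interval, both forwards (times
in `(s, t]`) and backwards (times in `[t, s)`). -/
def NonExplosive (η : Environment d) : Prop :=
  ∀ (u : Fin d → ℤ) (s t : ℝ),
    (s ≤ t → ∑' (n : ℕ) (v : Fin d → ℤ), η.jumpProb n s t u v = 1) ∧
    (t ≤ s → ∑' (n : ℕ) (v : Fin d → ℤ), η.reverse.jumpProb n (-s) (-t) u v = 1)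

/-- The probability that a Markov chain with transition probabilities `P^η`, which is at `u` at time
`s`, successively visits `v₁` at time `t₁`, `v₂` at time `t₂`, and so on along the given list:
`P^η_{s,t₁}(u, v₁) P^η_{t₁,t₂}(v₁, v₂) ⋯`. -/
def visitProb (η : Environment d) : ℝ → (Fin d → ℤ) → List (ℝ × (Fin d → ℤ)) → ℝ≥0∞
  | _, _, [] => 1
  | s, u, p :: l => η.transProb s p.1 u p.2 * visitProb η p.1 p.2 l

end Environment

/-- The one-point compactification `ℤ^d ∪ {∞}`, the state space of (possibly explosive) walks. -/
abbrev ExtLattice (d : ℕ) : Type := OnePoint (Fin d → ℤ)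

instance (d : ℕ) : MeasurableSpace (ExtLattice d) := borel _

instance (d : ℕ) : BorelSpace (ExtLattice d) := ⟨rfl⟩

/-- Right-continuous paths with left limits. -/
def IsCadlagPath {d : ℕ} (ζ : ℝ → ExtLattice d) : Prop :=
  ∀ t, ContinuousWithinAt ζ (Ici t) t ∧ ∃ l, Tendsto ζ (𝓝[<] t) (𝓝 l)

variable {d : ℕ} {Ω : Type*} [MeasurableSpace Ω]

/-- A random environment is stationary if its law is invariant under all space-time shifts. -/
def IsStationaryEnv (P : Measure Ω) (η : Ω → Environment d) : Prop :=
  ∀ (x : Fin d → ℤ) (t : ℝ), IdentDistrib (fun ω => (η ω).shift x t) η P P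

/-- `(X_t)_{t ∈ ℝ}` is a (doubly infinite) random walk in the random environment `η` started at `u`
at time `s`: it has càdlàg paths, and conditionally on `η` it is a Markov chain with the transition
probabilities `P^η` both forwards from time `s` and backwards from time `s`, the two being
conditionally independent. The lists `fwd` and `bwd` hold finitely many (time, position) pairs with
times going up, respectively down, from `s`. -/
structure IsRandomWalkIn (P : Measure Ω) (η : Ω → Environment d) (u : Fin d → ℤ) (s : ℝ)
    (X : ℝ → Ω → ExtLattice d) : Prop where
  measurable : ∀ t, Measurable (X t)
  cadlag : ∀ᵐ ω ∂P, IsCadlagPath (fun t => X t ω)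
  condLaw : ∀ fwd bwd : List (ℝ × (Fin d → ℤ)),
    (s :: fwd.map Prod.fst).Pairwise (· ≤ ·) → (s :: bwd.map Prod.fst).Pairwise (· ≥ ·) →
    condLExp (MeasurableSpace.comap η inferInstance) P
        ({ω | ∀ p ∈ fwd ++ bwd, X p.1 ω = (p.2 : ExtLattice d)}.indicator 1)
      =ᵐ[P] fun ω => (η ω).visitProb s u fwd * (η ω).visitProb s u bwd

/-- The processes `X` and `Y` are conditionally independent given `η`. (Events depending on the path
of `X` are described by the product σ-algebra, which on càdlàg paths is the Borel σ-algebra of the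
Skorohod topology.) -/
def CondIndepGiven (P : Measure Ω) (η : Ω → Environment d) (X Y : ℝ → Ω → ExtLattice d) : Prop :=
  ∀ A B : Set (ℝ → ExtLattice d), MeasurableSet A → MeasurableSet B →
    condLExp (MeasurableSpace.comap η inferInstance) P
        ({ω | (fun t => X t ω) ∈ A ∧ (fun t => Y t ω) ∈ B}.indicator 1)
      =ᵐ[P] fun ω =>
        condLExp (MeasurableSpace.comap η inferInstance) P
            ({ω' | (fun t => X t ω') ∈ A}.indicator 1) ω *
          condLExp (MeasurableSpace.comap η inferInstance) P
            ({ω' | (fun t => Y t ω') ∈ B}.indicator 1) ω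

end

/-!
The proof is a mass transport argument. Let `h(η)` be the probability that two independent walks in
`η`, both at the origin at time zero, do not meet at any of the times `1, 2, …`. By the Markov
property, the last meeting time of `X` and `Y` is `n`, and takes place at `v`, with probability
`E[P^η_{0,n}(0, v)² h(η seen from (v, n))]` (`measure_visitEvent_inter_noMeetEvent`). By
stationarity this is `E[P^η_{-n,0}(-v, 0)² h(η)]`. As conductances are symmetric, the walk is
reversible with respect to the counting measure, `P^η_{-n,0}(-v, 0) = P^η_{0,-n}(0, -v)`
(`Environment.transProb_symm`), so the sum over all `v` and `n` of these probabilities of disjoint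
events is `E[h(η) S(η)]` (`measure_lastMeetEvent`), where
`S(η) = ∑_n ∑_v P^η_{0,-n}(0, v)²` is the expected number of backward collisions given `η`
(`condLExp_collisions`). It is at most one, and `S = ∞` almost surely by assumption, so `h(η) = 0`
almost surely. Then each of the probabilities vanishes. There is almost surely no last meeting
time; since the walks meet at time zero, they meet infinitely often.

Applying stationarity requires the transition probabilities to be Borel functions of the
environment. The rates in their definition are arbitrary representatives of almost everywhere
classes. They may be replaced by upper limits of means over short time intervals
(`Environment.meanRate`), which are jointly measurable in the environment and time and agree with
the rates at almost every time by the Lebesgue differentiation theorem. Reversibility is proved by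
comparing the decomposition of a walk at its first jump, which defines `jumpProb`, with the
decomposition at its last jump (`Environment.jumpProb_succ_last`).
-/

noncomputable section

/-! ### Measurability of the jump probabilities in the environment -/

/-- An integral over an interval with measurably varying endpoints depends measurably on the
parameters. -/
theorem measurable_setLIntegral_Ioc {α : Type*} [MeasurableSpace α] {f : α × ℝ → ℝ≥0∞}
    (hf : Measurable f) {a b : α → ℝ} (ha : Measurable a) (hb : Measurable b) :
    Measurable fun x => ∫⁻ r in Ioc (a x) (b x), f (x, r) := by
  have hS : MeasurableSet {p : α × ℝ | a p.1 < p.2 ∧ p.2 ≤ b p.1} :=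
    (measurableSet_lt (ha.comp measurable_fst) measurable_snd).inter
      (measurableSet_le measurable_snd (hb.comp measurable_fst))
  have h := (hf.indicator hS).lintegral_prod_right' (ν := (volume : Measure ℝ))
  convert h using 2 with x
  rw [← lintegral_indicator measurableSet_Ioc]
  rfl

namespace Environment

variable {d : ℕ}

theorem intervalIntegrable_cond (η : Environment d) (e : LatticeEdge d) (a b : ℝ) :
    IntervalIntegrable (η.cond e) volume a b :=
  intervalIntegrable_iff.mpr
    (((η.locallyIntegrable e).integrableOn_isCompact isCompact_uIcc).mono_set uIoc_subset_uIcc)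

theorem continuous_toL1 (e : LatticeEdge d) (a b : ℝ) : Continuous (toL1 (d := d) e a b) := by
  refine continuous_iff_le_induced.mpr ?_
  exact (iInf_le _ e).trans ((iInf_le _ a).trans (iInf_le _ b))

theorem measurable_integral_cond (e : LatticeEdge d) {a b : ℝ} (hab : a ≤ b) :
    Measurable fun η : Environment d => ∫ r in a..b, η.cond e r := by
  have h : Continuous fun η : Environment d => ∫ r, toL1 e a b η r ∂(volume.restrict (Icc a b)) :=
    continuous_integral.comp (continuous_toL1 e a b)
  convert h.measurable using 2 with η
  rw [intervalIntegral.integral_of_le hab, ← integral_Icc_eq_integral_Ioc]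
  exact (integral_congr_ae (Integrable.coeFn_toL1 _)).symm

/-- The mean of the conductance of `e` over the time interval `[t, t + 1 / (k + 1)]`. -/
def meanCond (e : LatticeEdge d) (k : ℕ) (t : ℝ) (η : Environment d) : ℝ :=
  (1 / ((k : ℝ) + 1))⁻¹ * ∫ r in t..(t + 1 / ((k : ℝ) + 1)), η.cond e r

theorem measurable_meanCond (e : LatticeEdge d) (k : ℕ) :
    Measurable fun p : Environment d × ℝ => meanCond e k p.2 p.1 := by
  have h : Measurable (Function.uncurry (meanCond (d := d) e k)) := by
    refine measurable_uncurry_of_continuous_of_measurable (fun η => ?_) fun t => ?_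
    · have hp := intervalIntegral.continuous_primitive (η.intervalIntegrable_cond e) 0
      have h2 := hp.comp (continuous_add_const (1 / ((k : ℝ) + 1)))
      refine continuous_const.mul ((h2.sub hp).congr fun t => ?_)
      exact intervalIntegral.integral_interval_sub_left (η.intervalIntegrable_cond e _ _)
        (η.intervalIntegrable_cond e _ _)
    · have hk : 0 < 1 / ((k : ℝ) + 1) := Nat.one_div_pos_of_nat
      exact (measurable_integral_cond e (by linarith)).const_mul _
  exact h.comp measurable_swap

theorem tendsto_meanCond (η : Environment d) (e : LatticeEdge d) :
    ∀ᵐ t, Tendsto (fun k => meanCond e k t η) atTop (𝓝 (η.cond e t)) := by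
  filter_upwards [LocallyIntegrable.ae_hasDerivAt_integral (η.locallyIntegrable e)] with t ht
  have h1 := (ht t).tendsto_slope_zero_right
  have h2 : Tendsto (fun k : ℕ => 1 / ((k : ℝ) + 1)) atTop (𝓝[>] 0) :=
    tendsto_nhdsWithin_iff.mpr ⟨tendsto_one_div_add_atTop_nhds_zero_nat,
      Eventually.of_forall fun k => mem_Ioi.mpr Nat.one_div_pos_of_nat⟩
  refine (h1.comp h2).congr fun k => ?_
  simp [meanCond]

open Classical in
/-- A version of `Environment.rate` which is jointly measurable in the environment and in time: the
choice of representatives is replaced by an upper limit of means over short time intervals. -/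
def meanRate (η : Environment d) (x y : Fin d → ℤ) (t : ℝ) : ℝ≥0∞ :=
  if h : (latticeGraph d).Adj x y then
    limsup (fun k => ENNReal.ofReal (meanCond ⟨s(x, y), h⟩ k t η)) atTop else 0

theorem measurable_meanRate {α : Type*} [MeasurableSpace α] {f : α → Environment d} {g : α → ℝ}
    (hf : Measurable f) (hg : Measurable g) (x y : Fin d → ℤ) :
    Measurable fun a => (f a).meanRate x y (g a) := by
  by_cases h : (latticeGraph d).Adj x y
  · simp only [meanRate, h, dite_true]
    exact Measurable.limsup fun k =>
      ((measurable_meanCond _ k).comp (hf.prodMk hg)).ennreal_ofReal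
  · simp only [meanRate, h, dite_false]
    exact measurable_const

theorem rate_ae_eq_meanRate (η : Environment d) :
    ∀ᵐ t, ∀ x y, η.rate x y t = η.meanRate x y t := by
  refine ae_all_iff.mpr fun x => ae_all_iff.mpr fun y => ?_
  by_cases h : (latticeGraph d).Adj x y
  · filter_upwards [η.tendsto_meanCond ⟨s(x, y), h⟩] with t ht
    simp only [rate, meanRate, h, dite_true]
    exact ((ENNReal.continuous_ofReal.tendsto _).comp ht).limsup_eq.symm
  · simp [rate, meanRate, h]

theorem measurable_stayProb {α : Type*} [MeasurableSpace α] {f : α → Environment d} {g h : α → ℝ}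
    (hf : Measurable f) (hg : Measurable g) (hh : Measurable h) (x : Fin d → ℤ) :
    Measurable fun a => (f a).stayProb x (g a) (h a) := by
  have h1 : Measurable fun a => ∫⁻ r in Ioc (g a) (h a), ∑' y, (f a).meanRate x y r :=
    measurable_setLIntegral_Ioc (f := fun q : α × ℝ => ∑' y, (f q.1).meanRate x y q.2)
      (Measurable.tsum fun y => measurable_meanRate (hf.comp measurable_fst) measurable_snd x y)
      hg hh
  have h2 : ∀ a, ∫⁻ r in Ioc (g a) (h a), ∑' y, (f a).meanRate x y r =
      ∫⁻ r in Ioc (g a) (h a), (f a).exitRate x r := fun a => by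
    refine lintegral_congr_ae (ae_restrict_of_ae ?_)
    filter_upwards [(f a).rate_ae_eq_meanRate] with r hr
    simp [exitRate, hr]
  simp only [h2] at h1
  exact (Real.measurable_exp.comp h1.ennreal_toReal.neg).ennreal_ofReal

/-- The probability of a given number of jumps between two given sites is jointly measurable in the
environment and in the two times. -/
theorem measurable_jumpProb {α : Type*} [MeasurableSpace α] {f : α → Environment d} {g h : α → ℝ}
    (hf : Measurable f) (hg : Measurable g) (hh : Measurable h) (n : ℕ) (u v : Fin d → ℤ) :
    Measurable fun a => (f a).jumpProb n (g a) (h a) u v := by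
  have key : ∀ u, Measurable fun p : Environment d × ℝ × ℝ => p.1.jumpProb n p.2.1 p.2.2 u v := by
    induction n with
    | zero =>
      intro u
      by_cases h : u = v
      · simpa [jumpProb, h] using measurable_stayProb measurable_fst
          (measurable_fst.comp measurable_snd) (measurable_snd.comp measurable_snd) v
      · simp [jumpProb, h]
    | succ n ih =>
      intro u
      have h1 : Measurable fun p : Environment d × ℝ × ℝ => ∫⁻ r in Ioc p.2.1 p.2.2,
          p.1.stayProb u p.2.1 r * ∑' w, p.1.meanRate u w r * p.1.jumpProb n r p.2.2 w v := by
        refine measurable_setLIntegral_Ioc (f := fun q : (Environment d × ℝ × ℝ) × ℝ =>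
          q.1.1.stayProb u q.1.2.1 q.2 * ∑' w, q.1.1.meanRate u w q.2 *
            q.1.1.jumpProb n q.2 q.1.2.2 w v) ?_ (by fun_prop) (by fun_prop)
        have m1 : Measurable fun q : (Environment d × ℝ × ℝ) × ℝ => q.1.1 :=
          measurable_fst.comp measurable_fst
        have m2 : Measurable fun q : (Environment d × ℝ × ℝ) × ℝ => q.1.2.1 :=
          measurable_fst.comp (measurable_snd.comp measurable_fst)
        have m3 : Measurable fun q : (Environment d × ℝ × ℝ) × ℝ => q.1.2.2 :=
          measurable_snd.comp (measurable_snd.comp measurable_fst)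
        exact (measurable_stayProb m1 m2 measurable_snd u).mul (Measurable.tsum fun w =>
          (measurable_meanRate m1 measurable_snd u w).mul
            ((ih w).comp (m1.prodMk (measurable_snd.prodMk m3))))
      convert h1 using 2 with p
      refine lintegral_congr_ae (ae_restrict_of_ae ?_)
      filter_upwards [p.1.rate_ae_eq_meanRate] with r hr
      simp only [hr]
  exact (key u).comp (hf.prodMk (hg.prodMk hh))

/-! ### Covariance under space-time shifts -/

/-- Rates of the shifted environment; only almost every time is allowed, because representatives
are chosen independently for the two environments. -/
theorem rate_shift (η : Environment d) (z : Fin d → ℤ) (a : ℝ) :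
    ∀ᵐ t, ∀ x y, (η.shift z a).rate (x + z) (y + z) (t + a) = η.rate x y t := by
  refine ae_all_iff.mpr fun x => ae_all_iff.mpr fun y => ?_
  have hadj : (latticeGraph d).Adj (x + z) (y + z) ↔ (latticeGraph d).Adj x y := by
    simp [latticeGraph]
  by_cases h : (latticeGraph d).Adj x y
  · have h' := hadj.mpr h
    have he : LatticeEdge.sub (⟨s(x + z, y + z), h'⟩ : LatticeEdge d) z = ⟨s(x, y), h⟩ := by
      simp [LatticeEdge.sub]
    have h1 := (η.cond ⟨s(x, y), h⟩).coeFn_compMeasurePreserving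
      (measurePreserving_sub_right volume a)
    have h2 := (measurePreserving_add_right volume a).quasiMeasurePreserving.ae h1
    filter_upwards [h2] with t ht
    simp only [rate, h, h', dite_true, shift, he]
    rw [ht]
    simp
  · simp [rate, h, hadj]

theorem setLIntegral_Ioc_add (f : ℝ → ℝ≥0∞) (s t a : ℝ) :
    ∫⁻ r in Ioc (s + a) (t + a), f r = ∫⁻ r in Ioc s t, f (r + a) := by
  rw [← (measurePreserving_add_right volume a).setLIntegral_comp_preimage_emb
    (measurableEmbedding_addRight a)]
  simp

theorem exitRate_shift (η : Environment d) (z : Fin d → ℤ) (a : ℝ) :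
    ∀ᵐ t, ∀ x, (η.shift z a).exitRate (x + z) (t + a) = η.exitRate x t := by
  filter_upwards [η.rate_shift z a] with t ht x
  rw [exitRate, exitRate, ← (Equiv.addRight z).tsum_eq]
  simp [ht]

theorem stayProb_shift (η : Environment d) (z : Fin d → ℤ) (a s t : ℝ) (x : Fin d → ℤ) :
    (η.shift z a).stayProb (x + z) (s + a) (t + a) = η.stayProb x s t := by
  have h : ∫⁻ r in Ioc (s + a) (t + a), (η.shift z a).exitRate (x + z) r =
      ∫⁻ r in Ioc s t, η.exitRate x r := by
    rw [setLIntegral_Ioc_add]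
    refine lintegral_congr_ae (ae_restrict_of_ae ?_)
    filter_upwards [η.exitRate_shift z a] with r hr using hr x
  simp only [stayProb, h]

theorem jumpProb_shift (η : Environment d) (z : Fin d → ℤ) (a : ℝ) (n : ℕ) (s t : ℝ)
    (u v : Fin d → ℤ) :
    (η.shift z a).jumpProb n (s + a) (t + a) (u + z) (v + z) = η.jumpProb n s t u v := by
  induction n generalizing s u with
  | zero =>
    by_cases h : u = v
    · simp [jumpProb, h, stayProb_shift]
    · simp [jumpProb, h]
  | succ n ih =>
    simp only [jumpProb]
    rw [setLIntegral_Ioc_add]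
    refine lintegral_congr_ae (ae_restrict_of_ae ?_)
    filter_upwards [η.rate_shift z a] with r hr
    rw [← (Equiv.addRight z).tsum_eq]
    simp [hr, ih, stayProb_shift]

theorem transProb_shift (η : Environment d) (z : Fin d → ℤ) (a : ℝ) {s t : ℝ} (hst : s ≤ t)
    (u v : Fin d → ℤ) :
    (η.shift z a).transProb (s + a) (t + a) (u + z) (v + z) = η.transProb s t u v := by
  simp [transProb, hst, jumpProb_shift]

/-! ### Reversibility -/

theorem rate_comm (η : Environment d) (x y : Fin d → ℤ) (t : ℝ) :
    η.rate x y t = η.rate y x t := by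
  by_cases h : (latticeGraph d).Adj x y
  · have he : (⟨s(x, y), h⟩ : LatticeEdge d) = ⟨s(y, x), h.symm⟩ := Subtype.ext Sym2.eq_swap
    simp only [rate, h, h.symm, dite_true, he]
  · simp [rate, h, (latticeGraph d).adj_comm y x]

theorem rate_reverse (η : Environment d) :
    ∀ᵐ t, ∀ x y, η.reverse.rate x y (-t) = η.rate x y t := by
  refine ae_all_iff.mpr fun x => ae_all_iff.mpr fun y => ?_
  by_cases h : (latticeGraph d).Adj x y
  · have h1 := (η.cond ⟨s(x, y), h⟩).coeFn_compMeasurePreserving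
      (Measure.measurePreserving_neg volume)
    have h2 := (Measure.measurePreserving_neg (volume : Measure ℝ)).quasiMeasurePreserving.ae h1
    filter_upwards [h2] with t ht
    simp only [rate, h, dite_true, reverse]
    rw [ht]
    simp
  · simp [rate, h]

theorem setLIntegral_Ioc_neg (f : ℝ → ℝ≥0∞) (s t : ℝ) :
    ∫⁻ r in Ioc (-s) (-t), f r = ∫⁻ r in Ioc t s, f (-r) := by
  rw [← (Measure.measurePreserving_neg (volume : Measure ℝ)).setLIntegral_comp_preimage_emb
    (MeasurableEquiv.neg ℝ).measurableEmbedding]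
  simp only [Set.neg_preimage, Set.neg_Ioc, neg_neg]
  exact setLIntegral_congr Ico_ae_eq_Ioc

theorem stayProb_reverse (η : Environment d) (x : Fin d → ℤ) (s t : ℝ) :
    η.reverse.stayProb x (-s) (-t) = η.stayProb x t s := by
  have h : ∫⁻ r in Ioc (-s) (-t), η.reverse.exitRate x r = ∫⁻ r in Ioc t s, η.exitRate x r := by
    rw [setLIntegral_Ioc_neg]
    refine lintegral_congr_ae (ae_restrict_of_ae ?_)
    filter_upwards [η.rate_reverse] with r hr
    simp [exitRate, hr]
  simp only [stayProb, h]

theorem measurable_rate (η : Environment d) (x y : Fin d → ℤ) : Measurable (η.rate x y) := by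
  unfold rate
  split_ifs with h
  · exact (η.cond _).stronglyMeasurable.measurable.ennreal_ofReal
  · exact measurable_const

/-- Tonelli's theorem on the triangle `s < r < r' ≤ t`. -/
theorem lintegral_triangle_swap {F : ℝ → ℝ → ℝ≥0∞} (hF : Measurable (Function.uncurry F))
    (s t : ℝ) :
    ∫⁻ r in Ioc s t, ∫⁻ r' in Ioc r t, F r r' = ∫⁻ r' in Ioc s t, ∫⁻ r in Ioc s r', F r r' := by
  have hS : MeasurableSet {p : ℝ × ℝ | s < p.1 ∧ p.1 < p.2 ∧ p.2 ≤ t} := by measurability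
  have key := lintegral_lintegral_swap (μ := (volume : Measure ℝ)) (ν := (volume : Measure ℝ))
    (f := fun r r' => {p : ℝ × ℝ | s < p.1 ∧ p.1 < p.2 ∧ p.2 ≤ t}.indicator (Function.uncurry F)
      (r, r')) (hF.indicator hS).aemeasurable
  rw [← lintegral_indicator measurableSet_Ioc, ← lintegral_indicator measurableSet_Ioc]
  refine Eq.trans (lintegral_congr fun r => ?_) (key.trans (lintegral_congr fun r' => ?_))
  · by_cases hr : s < r ∧ r ≤ t
    · rw [indicator_of_mem (show r ∈ Ioc s t from hr), ← lintegral_indicator measurableSet_Ioc]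
      refine lintegral_congr fun r' => ?_
      simp [indicator, hr.1, Function.uncurry]
    · rw [indicator_of_notMem (show r ∉ Ioc s t from hr)]
      symm
      rw [lintegral_eq_zero_iff' (by measurability)]
      refine Eventually.of_forall fun r' => indicator_of_notMem (fun h => hr ?_) _
      exact ⟨h.1, (h.2.1.trans_le h.2.2).le⟩
  · by_cases hr : s < r' ∧ r' ≤ t
    · rw [indicator_of_mem (show r' ∈ Ioc s t from hr), ← setLIntegral_congr Ioo_ae_eq_Ioc,
        ← lintegral_indicator measurableSet_Ioo]
      refine lintegral_congr fun r => ?_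
      simp [indicator, hr.2, Function.uncurry]
    · rw [indicator_of_notMem (show r' ∉ Ioc s t from hr)]
      rw [lintegral_eq_zero_iff' (by measurability)]
      refine Eventually.of_forall fun r => indicator_of_notMem (fun h => hr ?_) _
      exact ⟨h.1.trans h.2.1, h.2.2⟩

/-- The decomposition of `jumpProb` according to the time of the last jump and the position just
before it. -/
theorem jumpProb_succ_last (η : Environment d) (n : ℕ) (s t : ℝ) (u v : Fin d → ℤ) :
    η.jumpProb (n + 1) s t u v = ∫⁻ r in Ioc s t, (∑' w, η.jumpProb n s r u w * η.rate w v r) *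
      η.stayProb v r t := by
  induction n generalizing s u with
  | zero =>
    simp only [jumpProb]
    refine lintegral_congr fun r => ?_
    rw [tsum_eq_single v (fun w hw => by simp [hw]),
      tsum_eq_single u (fun w hw => by simp [hw.symm])]
    simp [mul_assoc]
  | succ n ih =>
    have mJ {α : Type} [MeasurableSpace α] {g h : α → ℝ} (hg : Measurable g) (hh : Measurable h)
        (w w' : Fin d → ℤ) : Measurable fun a => η.jumpProb n (g a) (h a) w w' :=
      measurable_jumpProb measurable_const hg hh n w w'
    have mS {α : Type} [MeasurableSpace α] {g h : α → ℝ} (hg : Measurable g) (hh : Measurable h)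
        (w : Fin d → ℤ) : Measurable fun a => η.stayProb w (g a) (h a) :=
      measurable_stayProb measurable_const hg hh w
    have mR {α : Type} [MeasurableSpace α] {g : α → ℝ} (hg : Measurable g)
        (w w' : Fin d → ℤ) : Measurable fun a => η.rate w w' (g a) :=
      (η.measurable_rate w w').comp hg
    set F : ℝ → ℝ → ℝ≥0∞ := fun r r' => ∑' w, ∑' w', η.stayProb u s r * η.rate u w r *
      η.jumpProb n r r' w w' * η.rate w' v r' * η.stayProb v r' t with hF
    have mF : Measurable (Function.uncurry F) :=
      Measurable.tsum fun w => Measurable.tsum fun w' =>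
        ((((mS measurable_const measurable_fst u).mul (mR measurable_fst u w)).mul
          (mJ measurable_fst measurable_snd w w')).mul (mR measurable_snd w' v)).mul
          (mS measurable_snd measurable_const v)
    rw [jumpProb]
    calc ∫⁻ r in Ioc s t, η.stayProb u s r * ∑' w, η.rate u w r * η.jumpProb (n + 1) r t w v
        = ∫⁻ r in Ioc s t, ∫⁻ r' in Ioc r t, F r r' := by
          refine lintegral_congr fun r => ?_
          have mG (w : Fin d → ℤ) : Measurable fun r' => ∑' w', η.stayProb u s r * η.rate u w r *
              η.jumpProb n r r' w w' * η.rate w' v r' * η.stayProb v r' t :=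
            Measurable.tsum fun w' => (((mJ measurable_const measurable_id w w').const_mul _).mul
              (mR measurable_id w' v)).mul (mS measurable_id measurable_const v)
          simp only [hF]
          rw [lintegral_tsum fun w => (mG w).aemeasurable, ← ENNReal.tsum_mul_left]
          refine tsum_congr fun w => ?_
          rw [ih, ← mul_assoc, ← lintegral_const_mul]
          · refine lintegral_congr fun r' => ?_
            rw [← ENNReal.tsum_mul_right, ← ENNReal.tsum_mul_left]
            exact tsum_congr fun w' => by ring
          · exact (Measurable.tsum fun w' => (mJ measurable_const measurable_id w w').mul
              (mR measurable_id w' v)).mul (mS measurable_id measurable_const v)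
      _ = ∫⁻ r' in Ioc s t, ∫⁻ r in Ioc s r', F r r' := lintegral_triangle_swap mF s t
      _ = _ := by
          refine lintegral_congr fun r' => ?_
          simp only [hF]
          have hcomm : ∀ r, (∑' w, ∑' w', η.stayProb u s r * η.rate u w r *
              η.jumpProb n r r' w w' * η.rate w' v r' * η.stayProb v r' t) =
              ∑' w', (η.stayProb u s r * ∑' w, η.rate u w r * η.jumpProb n r r' w w') *
                (η.rate w' v r' * η.stayProb v r' t) := fun r => by
            rw [ENNReal.tsum_comm]
            refine tsum_congr fun w' => ?_
            rw [← ENNReal.tsum_mul_left, ← ENNReal.tsum_mul_right]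
            exact tsum_congr fun w => by ring
          have mG (w' : Fin d → ℤ) : Measurable fun r =>
              η.stayProb u s r * ∑' w, η.rate u w r * η.jumpProb n r r' w w' :=
            (mS measurable_const measurable_id u).mul (Measurable.tsum fun w =>
              (mR measurable_id u w).mul (mJ measurable_id measurable_const w w'))
          simp only [hcomm]
          rw [lintegral_tsum fun w' => ((mG w').mul_const _).aemeasurable,
            ← ENNReal.tsum_mul_right]
          refine tsum_congr fun w' => ?_
          rw [lintegral_mul_const _ (mG w'), jumpProb, mul_assoc]

/-- Time reversal exchanges the two endpoints of a walk, because conductances are symmetric. -/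
theorem jumpProb_reverse (η : Environment d) (n : ℕ) (s t : ℝ) (u v : Fin d → ℤ) :
    η.reverse.jumpProb n (-s) (-t) u v = η.jumpProb n t s v u := by
  induction n generalizing t v with
  | zero =>
    by_cases h : u = v
    · simp [jumpProb, h, stayProb_reverse]
    · simp [jumpProb, h, Ne.symm h]
  | succ n ih =>
    rw [jumpProb_succ_last, jumpProb, setLIntegral_Ioc_neg]
    refine lintegral_congr_ae (ae_restrict_of_ae ?_)
    filter_upwards [η.rate_reverse] with r hr
    rw [stayProb_reverse, mul_comm]
    congr 1
    refine tsum_congr fun w => ?_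
    rw [hr, ih, rate_comm, mul_comm]

theorem transProb_self (η : Environment d) (s : ℝ) (u v : Fin d → ℤ) :
    η.transProb s s u v = if u = v then 1 else 0 := by
  rw [transProb, if_pos le_rfl, tsum_eq_single 0]
  · by_cases h : u = v <;> simp [jumpProb, stayProb, h]
  · intro n hn
    obtain ⟨m, rfl⟩ := Nat.exists_eq_succ_of_ne_zero hn
    simp [jumpProb]

/-- Reversibility of the walk with respect to the counting measure. -/
theorem transProb_symm (η : Environment d) (s t : ℝ) (u v : Fin d → ℤ) :
    η.transProb s t u v = η.transProb t s v u := by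
  rcases lt_trichotomy s t with h | rfl | h
  · simp [transProb, h.le, h.not_ge, jumpProb_reverse]
  · simp [transProb_self, eq_comm]
  · simp [transProb, h.le, h.not_ge, jumpProb_reverse]

theorem measurable_transProb (s t : ℝ) (u v : Fin d → ℤ) :
    Measurable fun η : Environment d => η.transProb s t u v := by
  have h {s t : ℝ} (hst : s ≤ t) (u v : Fin d → ℤ) :
      Measurable fun η : Environment d => η.transProb s t u v := by
    simp only [transProb, hst, if_true]
    exact Measurable.tsum fun n =>
      measurable_jumpProb measurable_id measurable_const measurable_const n u v
  rcases le_total s t with hst | hst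
  · exact h hst u v
  · simpa only [transProb_symm _ s t] using h hst v u

end Environment

/-! ### Chains that do not meet -/

namespace Environment

variable {d : ℕ}

theorem tsum_transProb {η : Environment d} (hη : η.NonExplosive) (s t : ℝ) (u : Fin d → ℤ) :
    ∑' v, η.transProb s t u v = 1 := by
  by_cases h : s ≤ t
  · simp only [transProb, h, if_true]
    rw [ENNReal.tsum_comm]
    exact (hη u s t).1 h
  · simp only [transProb, h, if_false]
    rw [ENNReal.tsum_comm]
    exact (hη u s t).2 (le_of_not_ge h)

theorem transProb_le_one {η : Environment d} (hη : η.NonExplosive) (s t : ℝ) (u v : Fin d → ℤ) :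
    η.transProb s t u v ≤ 1 :=
  (ENNReal.le_tsum v).trans_eq (tsum_transProb hη s t u)

theorem measurable_visitProb (s : ℝ) (u : Fin d → ℤ) (l : List (ℝ × (Fin d → ℤ))) :
    Measurable fun η : Environment d => η.visitProb s u l := by
  induction l generalizing s u with
  | nil => exact measurable_const
  | cons p l ih => exact (measurable_transProb _ _ _ _).mul (ih _ _)

/-- The Markov property of `visitProb`: appending a visit `q` after the visit `p` costs one
transition from `p` to `q`. -/
theorem visitProb_append_two (η : Environment d) (s : ℝ) (u : Fin d → ℤ)
    (l : List (ℝ × (Fin d → ℤ))) (p q : ℝ × (Fin d → ℤ)) :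
    η.visitProb s u (l ++ [p] ++ [q]) =
      η.visitProb s u (l ++ [p]) * η.transProb p.1 q.1 p.2 q.2 := by
  induction l generalizing s u with
  | nil => simp [visitProb]
  | cons r l ih =>
    simp only [List.cons_append, visitProb]
    rw [ih, mul_assoc]

open Classical in
/-- The probability that two independent chains with transition probabilities `P^η`, at `x` and `y`
at time `s`, are at different sites at each of the times `s + 1, …, s + K`. -/
def noMeetProb (η : Environment d) : ℕ → ℝ → (Fin d → ℤ) → (Fin d → ℤ) → ℝ≥0∞
  | 0, _, _, _ => 1
  | K + 1, s, x, y => ∑' x', ∑' y', if x' = y' then 0 else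
      η.transProb s (s + 1) x x' * η.transProb s (s + 1) y y' * noMeetProb η K (s + 1) x' y'

theorem measurable_noMeetProb (K : ℕ) (s : ℝ) (x y : Fin d → ℤ) :
    Measurable fun η : Environment d => η.noMeetProb K s x y := by
  induction K generalizing s x y with
  | zero => exact measurable_const
  | succ K ih =>
    refine Measurable.tsum fun x' => Measurable.tsum fun y' => ?_
    by_cases h : x' = y'
    · simp [h]
    · simp only [h, if_false]
      exact ((measurable_transProb _ _ _ _).mul (measurable_transProb _ _ _ _)).mul (ih _ _ _)

theorem noMeetProb_shift (η : Environment d) (z : Fin d → ℤ) (a : ℝ) (K : ℕ) (s : ℝ)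
    (x y : Fin d → ℤ) :
    (η.shift z a).noMeetProb K (s + a) (x + z) (y + z) = η.noMeetProb K s x y := by
  induction K generalizing s x y with
  | zero => rfl
  | succ K ih =>
    simp only [noMeetProb]
    rw [← (Equiv.addRight z).tsum_eq]
    refine tsum_congr fun x' => ?_
    rw [← (Equiv.addRight z).tsum_eq]
    refine tsum_congr fun y' => ?_
    have h : s + a + 1 = s + 1 + a := by ring
    have hs : s ≤ s + 1 := by linarith
    simp only [Equiv.coe_addRight, add_left_inj, h, transProb_shift _ _ _ hs, ih]

theorem noMeetProb_succ_le {η : Environment d} (hη : η.NonExplosive) (K : ℕ) (s : ℝ)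
    (x y : Fin d → ℤ) : η.noMeetProb (K + 1) s x y ≤ η.noMeetProb K s x y := by
  induction K generalizing s x y with
  | zero =>
    calc η.noMeetProb 1 s x y
        ≤ ∑' x', ∑' y', η.transProb s (s + 1) x x' * η.transProb s (s + 1) y y' := by
          refine ENNReal.tsum_le_tsum fun x' => ENNReal.tsum_le_tsum fun y' => ?_
          split_ifs <;> simp [noMeetProb]
      _ = 1 := by simp [ENNReal.tsum_mul_left, tsum_transProb hη]
  | succ K ih =>
    refine ENNReal.tsum_le_tsum fun x' => ENNReal.tsum_le_tsum fun y' => ?_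
    split_ifs
    · exact le_rfl
    · gcongr
      exact ih _ _ _

theorem antitone_noMeetProb {η : Environment d} (hη : η.NonExplosive) (s : ℝ)
    (x y : Fin d → ℤ) : Antitone fun K => η.noMeetProb K s x y :=
  antitone_nat_of_succ_le fun K => noMeetProb_succ_le hη K s x y

end Environment

/-! ### The joint law of the two walks -/

instance (d : ℕ) : Countable (ExtLattice d) := inferInstanceAs (Countable (Option (Fin d → ℤ)))

variable {d : ℕ} {Ω : Type*} {X Y : ℝ → Ω → ExtLattice d}

/-- The event that a process visits the given sites at the given times. -/
def visitEvent (X : ℝ → Ω → ExtLattice d) (l : List (ℝ × (Fin d → ℤ))) : Set Ω :=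
  {ω | ∀ p ∈ l, X p.1 ω = (p.2 : ExtLattice d)}

/-- The event that the two processes differ at the times `s + 1, …, s + K`. -/
def noMeetEvent (X Y : ℝ → Ω → ExtLattice d) (K : ℕ) (s : ℝ) : Set Ω :=
  {ω | ∀ i < K, X (s + 1 + i) ω ≠ Y (s + 1 + i) ω}

theorem noMeetEvent_succ (K : ℕ) (s : ℝ) :
    noMeetEvent X Y (K + 1) s = {ω | X (s + 1) ω ≠ Y (s + 1) ω} ∩ noMeetEvent X Y K (s + 1) := by
  ext ω
  simp only [noMeetEvent, mem_ofPred_eq, mem_inter_iff]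
  constructor
  · intro h
    refine ⟨by simpa using h 0 K.succ_pos, fun i hi => ?_⟩
    have := h (i + 1) (by omega)
    rwa [show s + 1 + ((i + 1 : ℕ) : ℝ) = s + 1 + 1 + i by push_cast; ring] at this
  · rintro ⟨h0, h⟩ i hi
    rcases i with _ | i
    · simpa using h0
    · rw [show s + 1 + ((i + 1 : ℕ) : ℝ) = s + 1 + 1 + i by push_cast; ring]
      exact h i (by omega)

/-- The event that the last collision at a nonnegative integer time happens at time `n` at `v`. -/
def lastMeetEvent (X Y : ℝ → Ω → ExtLattice d) (n : ℕ) (v : Fin d → ℤ) : Set Ω :=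
  ⋂ K, visitEvent X [((n : ℝ), v)] ∩ visitEvent Y [((n : ℝ), v)] ∩ noMeetEvent X Y K n

theorem mem_lastMeetEvent {n : ℕ} {v : Fin d → ℤ} {ω : Ω} :
    ω ∈ lastMeetEvent X Y n v ↔ X n ω = (v : ExtLattice d) ∧ Y n ω = (v : ExtLattice d) ∧
      ∀ m > n, X (m : ℝ) ω ≠ Y (m : ℝ) ω := by
  simp only [lastMeetEvent, visitEvent, noMeetEvent, List.mem_singleton, forall_eq, mem_iInter,
    mem_inter_iff, mem_ofPred_eq]
  constructor
  · intro h
    refine ⟨(h 0).1.1, (h 0).1.2, fun m hm => ?_⟩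
    obtain ⟨i, rfl⟩ := Nat.exists_eq_add_of_lt hm
    have := (h (i + 1)).2 i (by omega)
    rwa [show ((n + i + 1 : ℕ) : ℝ) = (n : ℝ) + 1 + i by push_cast; ring]
  · rintro ⟨h1, h2, h⟩ K
    refine ⟨⟨h1, h2⟩, fun i _ => ?_⟩
    have := h (n + i + 1) (by omega)
    rwa [show ((n + i + 1 : ℕ) : ℝ) = (n : ℝ) + 1 + i by push_cast; ring] at this

variable [MeasurableSpace Ω] {P : Measure Ω} {η : Ω → Environment d}

theorem measurableSet_collision (hX : ∀ t, Measurable (X t)) (hY : ∀ t, Measurable (Y t)) (t : ℝ) :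
    MeasurableSet {ω | X t ω = Y t ω} := by
  have h : {ω | X t ω = Y t ω} = ⋃ z, X t ⁻¹' {z} ∩ Y t ⁻¹' {z} := by
    ext ω
    simp [eq_comm]
  rw [h]
  exact MeasurableSet.iUnion fun z =>
    (hX t (measurableSet_singleton z)).inter (hY t (measurableSet_singleton z))

theorem measurableSet_visitEvent (hX : ∀ t, Measurable (X t)) (l : List (ℝ × (Fin d → ℤ))) :
    MeasurableSet (visitEvent X l) := by
  have h : visitEvent X l = ⋂ p ∈ l, X p.1 ⁻¹' {(p.2 : ExtLattice d)} := by
    ext ω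
    simp [visitEvent]
  rw [h]
  exact MeasurableSet.biInter l.finite_toSet.countable fun p _ =>
    hX p.1 (measurableSet_singleton _)

theorem measurableSet_path_visit (l : List (ℝ × (Fin d → ℤ))) :
    MeasurableSet {ζ : ℝ → ExtLattice d | ∀ p ∈ l, ζ p.1 = (p.2 : ExtLattice d)} :=
  measurableSet_visitEvent (X := fun (t : ℝ) (ζ : ℝ → ExtLattice d) => ζ t) measurable_pi_apply l

theorem measurableSet_noMeetEvent (hX : ∀ t, Measurable (X t)) (hY : ∀ t, Measurable (Y t))
    (K : ℕ) (s : ℝ) : MeasurableSet (noMeetEvent X Y K s) := by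
  have h : noMeetEvent X Y K s =
      ⋂ i ∈ {i | i < K}, {ω | X (s + 1 + (i : ℕ)) ω = Y (s + 1 + (i : ℕ)) ω}ᶜ := by
    ext ω
    simp [noMeetEvent]
  rw [h]
  exact MeasurableSet.biInter (Set.to_countable _) fun i _ => (measurableSet_collision hX hY _).compl

/-- Decomposition of an event according to the value of an almost surely finite variable. -/
theorem measure_eq_tsum_inter {Z : Ω → ExtLattice d} (hZ : Measurable Z)
    (hfin : ∀ᵐ ω ∂P, Z ω ≠ OnePoint.infty) {E : Set Ω} (hE : MeasurableSet E) :
    P E = ∑' v : Fin d → ℤ, P (E ∩ Z ⁻¹' {(v : ExtLattice d)}) := by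
  rw [← measure_iUnion]
  · refine measure_congr ?_
    filter_upwards [hfin] with ω hω
    obtain ⟨v, hv⟩ := OnePoint.ne_infty_iff_exists.mp hω
    refine propext ⟨fun h => mem_iUnion.mpr ⟨v, h, hv.symm⟩, fun h => ?_⟩
    obtain ⟨w, hw⟩ := mem_iUnion.mp h
    exact hw.1
  · intro v w hvw
    refine Set.disjoint_left.mpr fun ω h1 h2 => hvw ?_
    have h1 := h1.2
    have h2 := h2.2
    simp only [mem_preimage, mem_singleton_iff] at h1 h2
    exact OnePoint.coe_injective (h1.symm.trans h2)
  · exact fun v => hE.inter (hZ (measurableSet_singleton _))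

variable [IsProbabilityMeasure P]

theorem IsRandomWalkIn.measure_visitEvent (hX : IsRandomWalkIn P η 0 0 X) (hη : Measurable η)
    {fwd bwd : List (ℝ × (Fin d → ℤ))} (hf : (0 :: fwd.map Prod.fst).Pairwise (· ≤ ·))
    (hb : (0 :: bwd.map Prod.fst).Pairwise (· ≥ ·)) :
    P (visitEvent X (fwd ++ bwd)) =
      ∫⁻ ω, (η ω).visitProb 0 0 fwd * (η ω).visitProb 0 0 bwd ∂P := by
  have h := hX.condLaw fwd bwd hf hb
  rw [← lintegral_congr_ae h, lintegral_condLExp hη.comap_le]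
  exact (lintegral_indicator_one (measurableSet_visitEvent hX.measurable _)).symm

/-- The joint law of two conditionally independent walks, on events determined by the
environment. -/
theorem measure_inter_visitEvent (hη : Measurable η) (hX : IsRandomWalkIn P η 0 0 X)
    (hY : IsRandomWalkIn P η 0 0 Y) (hXY : CondIndepGiven P η X Y)
    {fwd bwd fwd' bwd' : List (ℝ × (Fin d → ℤ))}
    (hf : (0 :: fwd.map Prod.fst).Pairwise (· ≤ ·))
    (hb : (0 :: bwd.map Prod.fst).Pairwise (· ≥ ·))
    (hf' : (0 :: fwd'.map Prod.fst).Pairwise (· ≤ ·))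
    (hb' : (0 :: bwd'.map Prod.fst).Pairwise (· ≥ ·))
    {A : Set Ω} (hA : MeasurableSet[MeasurableSpace.comap η inferInstance] A) :
    P (A ∩ (visitEvent X (fwd ++ bwd) ∩ visitEvent Y (fwd' ++ bwd'))) =
      ∫⁻ ω in A, (η ω).visitProb 0 0 fwd * (η ω).visitProb 0 0 bwd *
        ((η ω).visitProb 0 0 fwd' * (η ω).visitProb 0 0 bwd') ∂P := by
  have h1 := hX.condLaw fwd bwd hf hb
  have h2 := hY.condLaw fwd' bwd' hf' hb'
  have h3 := hXY _ _ (measurableSet_path_visit (fwd ++ bwd))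
    (measurableSet_path_visit (fwd' ++ bwd'))
  have hm : MeasurableSet (visitEvent X (fwd ++ bwd) ∩ visitEvent Y (fwd' ++ bwd')) :=
    (measurableSet_visitEvent hX.measurable _).inter (measurableSet_visitEvent hY.measurable _)
  have h4 : ∫⁻ ω in A, (η ω).visitProb 0 0 fwd * (η ω).visitProb 0 0 bwd *
      ((η ω).visitProb 0 0 fwd' * (η ω).visitProb 0 0 bwd') ∂P =
      ∫⁻ ω in A, condLExp (MeasurableSpace.comap η inferInstance) P
        ((visitEvent X (fwd ++ bwd) ∩ visitEvent Y (fwd' ++ bwd')).indicator 1) ω ∂P := by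
    refine lintegral_congr_ae (ae_restrict_of_ae ?_)
    filter_upwards [h1, h2, h3] with ω w1 w2 w3
    rw [← w1, ← w2]
    exact w3.symm
  rw [h4, setLIntegral_condLExp hη.comap_le P _ hA, lintegral_indicator_one hm,
    Measure.restrict_apply hm, inter_comm]

/-- The state at a fixed time is almost surely not the point at infinity. -/
theorem IsRandomWalkIn.ae_ne_infty (hX : IsRandomWalkIn P η 0 0 X) (hη : Measurable η)
    (hne : ∀ᵐ ω ∂P, (η ω).NonExplosive) (t : ℝ) : ∀ᵐ ω ∂P, X t ω ≠ OnePoint.infty := by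
  have hlaw (v : Fin d → ℤ) :
      P (X t ⁻¹' {(v : ExtLattice d)}) = ∫⁻ ω, (η ω).transProb 0 t 0 v ∂P := by
    have hset (l : List (ℝ × (Fin d → ℤ))) (hl : l = [(t, v)]) :
        X t ⁻¹' {(v : ExtLattice d)} = visitEvent X l := by
      ext ω
      simp [visitEvent, hl]
    rcases le_total 0 t with ht | ht
    · rw [hset ([(t, v)] ++ []) rfl, hX.measure_visitEvent hη (by simpa using ht) (by simp)]
      simp [Environment.visitProb]
    · rw [hset ([] ++ [(t, v)]) rfl, hX.measure_visitEvent hη (by simp) (by simpa using ht)]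
      simp [Environment.visitProb]
  have hone : P (⋃ v : Fin d → ℤ, X t ⁻¹' {(v : ExtLattice d)}) = 1 := by
    rw [measure_iUnion]
    · simp only [hlaw]
      have hm (v : Fin d → ℤ) : Measurable fun ω => (η ω).transProb 0 t 0 v :=
        (Environment.measurable_transProb 0 t 0 v).comp hη
      rw [← lintegral_tsum fun v => (hm v).aemeasurable, lintegral_congr_ae (g := fun _ => 1)]
      · simp
      · filter_upwards [hne] with ω hω using Environment.tsum_transProb hω 0 t 0
    · intro v w hvw
      refine Set.disjoint_left.mpr fun ω h1 h2 => hvw ?_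
      simp only [mem_preimage, mem_singleton_iff] at h1 h2
      exact OnePoint.coe_injective (h1.symm.trans h2)
    · exact fun v => hX.measurable t (measurableSet_singleton _)
  have hmeas : MeasurableSet (⋃ v : Fin d → ℤ, X t ⁻¹' {(v : ExtLattice d)}) :=
    MeasurableSet.iUnion fun v => hX.measurable t (measurableSet_singleton _)
  have h0 := (prob_compl_eq_zero_iff hmeas).mpr hone
  filter_upwards [compl_mem_ae_iff.mpr h0] with ω hω h
  simp [h] at hω

/-- The Markov property of the pair of walks: after visiting given sites up to time `s`, the walks
avoid each other at the next `K` integer steps with the probability `noMeetProb`. -/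
theorem measure_visitEvent_inter_noMeetEvent (hη : Measurable η)
    (hne : ∀ᵐ ω ∂P, (η ω).NonExplosive) (hX : IsRandomWalkIn P η 0 0 X)
    (hY : IsRandomWalkIn P η 0 0 Y) (hXY : CondIndepGiven P η X Y) (K : ℕ) {s : ℝ} (hs : 0 ≤ s)
    {l l' : List (ℝ × (Fin d → ℤ))} (hl : (0 :: l.map Prod.fst).Pairwise (· ≤ ·))
    (hls : ∀ p ∈ l, p.1 ≤ s) (hl' : (0 :: l'.map Prod.fst).Pairwise (· ≤ ·))
    (hls' : ∀ p ∈ l', p.1 ≤ s) (x y : Fin d → ℤ) :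
    P (visitEvent X (l ++ [(s, x)]) ∩ visitEvent Y (l' ++ [(s, y)]) ∩ noMeetEvent X Y K s) =
      ∫⁻ ω, (η ω).visitProb 0 0 (l ++ [(s, x)]) * (η ω).visitProb 0 0 (l' ++ [(s, y)]) *
        (η ω).noMeetProb K s x y ∂P := by
  have hsort {l : List (ℝ × (Fin d → ℤ))} {s : ℝ} (hs : 0 ≤ s)
      (hl : (0 :: l.map Prod.fst).Pairwise (· ≤ ·)) (hls : ∀ p ∈ l, p.1 ≤ s) (x : Fin d → ℤ) :
      (0 :: (l ++ [(s, x)]).map Prod.fst).Pairwise (· ≤ ·) := by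
    rw [List.map_append, ← List.cons_append, List.pairwise_append]
    refine ⟨hl, by simp, fun a ha b hb => ?_⟩
    simp only [List.map_cons, List.map_nil, List.mem_singleton] at hb
    subst hb
    rcases List.mem_cons.mp ha with rfl | ha
    · exact hs
    · obtain ⟨p, hp, rfl⟩ := List.mem_map.mp ha
      exact hls p hp
  induction K generalizing s l l' x y with
  | zero =>
    have h := measure_inter_visitEvent hη hX hY hXY (bwd := []) (bwd' := []) (hsort hs hl hls x)
      (by simp) (hsort hs hl' hls' y) (by simp) MeasurableSet.univ
    simpa [noMeetEvent, Environment.noMeetProb, Environment.visitProb] using h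
  | succ K ih =>
    have hstep {l : List (ℝ × (Fin d → ℤ))} (hls : ∀ p ∈ l, p.1 ≤ s) (x : Fin d → ℤ) :
        ∀ p ∈ l ++ [(s, x)], p.1 ≤ s + 1 := by
      intro p hp
      rcases List.mem_append.mp hp with hp | hp
      · linarith [hls p hp]
      · rw [List.mem_singleton.mp hp]
        simp
    have hE : MeasurableSet (visitEvent X (l ++ [(s, x)]) ∩ visitEvent Y (l' ++ [(s, y)]) ∩
        noMeetEvent X Y (K + 1) s) :=
      ((measurableSet_visitEvent hX.measurable _).inter
        (measurableSet_visitEvent hY.measurable _)).inter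
        (measurableSet_noMeetEvent hX.measurable hY.measurable _ _)
    have hmeas (x' y' : Fin d → ℤ) : Measurable fun ω => if x' = y' then 0 else
        (η ω).visitProb 0 0 (l ++ [(s, x)]) * (η ω).visitProb 0 0 (l' ++ [(s, y)]) *
        ((η ω).transProb s (s + 1) x x' * (η ω).transProb s (s + 1) y y' *
          (η ω).noMeetProb K (s + 1) x' y') := by
      by_cases h : x' = y'
      · simp [h]
      · simp only [h, if_false]
        exact ((((Environment.measurable_visitProb _ _ _).mul
          (Environment.measurable_visitProb _ _ _)).mul
          (((Environment.measurable_transProb _ _ _ _).mul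
          (Environment.measurable_transProb _ _ _ _)).mul
          (Environment.measurable_noMeetProb _ _ _ _))).comp hη)
    rw [measure_eq_tsum_inter (hX.measurable (s + 1)) (hX.ae_ne_infty hη hne _) hE]
    simp only [Environment.noMeetProb]
    simp_rw [← ENNReal.tsum_mul_left]
    simp_rw [mul_ite, mul_zero]
    rw [lintegral_tsum fun x' => (Measurable.tsum fun y' => hmeas x' y').aemeasurable]
    refine tsum_congr fun x' => ?_
    rw [lintegral_tsum fun y' => (hmeas x' y').aemeasurable,
      measure_eq_tsum_inter (hY.measurable (s + 1)) (hY.ae_ne_infty hη hne _)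
        (hE.inter (hX.measurable _ (measurableSet_singleton _)))]
    refine tsum_congr fun y' => ?_
    rw [noMeetEvent_succ]
    by_cases h : x' = y'
    · subst h
      simp only [if_true, lintegral_zero]
      convert measure_empty (μ := P)
      refine eq_empty_of_forall_notMem ?_
      rintro ω ⟨⟨⟨_, h1, _⟩, h2⟩, h3⟩
      exact h1 (h2.trans h3.symm)
    · simp only [h, if_false]
      have key := ih (by linarith : 0 ≤ s + 1) (hsort hs hl hls x) (hstep hls x)
        (hsort hs hl' hls' y) (hstep hls' y) x' y'
      simp only [Environment.visitProb_append_two] at key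
      refine Eq.trans ?_ (key.trans (lintegral_congr fun ω => by ring))
      congr 1
      ext ω
      simp only [visitEvent, List.mem_append, List.mem_singleton, mem_inter_iff, mem_ofPred_eq,
        mem_preimage, mem_singleton_iff, or_imp, forall_and, forall_eq]
      constructor
      · rintro ⟨⟨⟨⟨h1, h2⟩, -, h4⟩, h5⟩, h6⟩
        exact ⟨⟨⟨h1, h5⟩, h2, h6⟩, h4⟩
      · rintro ⟨⟨⟨h1, h5⟩, h2, h6⟩, h4⟩
        refine ⟨⟨⟨⟨h1, h2⟩, ?_, h4⟩, h5⟩, h6⟩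
        rw [h5, h6]
        exact fun h' => h (OnePoint.coe_injective h')

/-! ### Mass transport from the last collision to the origin -/

/-- The expected number of collisions at the times `0, -1, -2, …` of two independent walks in `η`
started at the origin, counting finite positions only. -/
def Environment.backwardCollisions (η : Environment d) : ℝ≥0∞ :=
  ∑' (n : ℕ) (v : Fin d → ℤ), η.transProb 0 (-(n : ℝ)) 0 v * η.transProb 0 (-(n : ℝ)) 0 v

theorem Environment.measurable_backwardCollisions :
    Measurable (Environment.backwardCollisions (d := d)) :=
  Measurable.tsum fun _ => Measurable.tsum fun _ =>
    (measurable_transProb _ _ _ _).mul (measurable_transProb _ _ _ _)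

/-- The expected number of backward collisions given `η`. Collisions at the point at infinity do not
contribute, because the walks are almost surely finite. -/
theorem condLExp_collisions (hη : Measurable η) (hne : ∀ᵐ ω ∂P, (η ω).NonExplosive)
    (hX : IsRandomWalkIn P η 0 0 X) (hY : IsRandomWalkIn P η 0 0 Y)
    (hXY : CondIndepGiven P η X Y) :
    (fun ω => (η ω).backwardCollisions) =ᵐ[P]
      condLExp (MeasurableSpace.comap η inferInstance) P
        (fun ω' => ∑' n : ℕ, {ω'' | X (-(n : ℝ)) ω'' = Y (-(n : ℝ)) ω''}.indicator 1 ω') := by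
  have hcol (n : ℕ) := measurableSet_collision hX.measurable hY.measurable (-(n : ℝ))
  have hm (n : ℕ) (v : Fin d → ℤ) : Measurable fun ω =>
      (η ω).transProb 0 (-(n : ℝ)) 0 v * (η ω).transProb 0 (-(n : ℝ)) 0 v :=
    ((Environment.measurable_transProb _ _ _ _).mul
      (Environment.measurable_transProb _ _ _ _)).comp hη
  refine ae_eq_condLExp hη.comap_le P _
    (Environment.measurable_backwardCollisions.comp (comap_measurable η)) fun A hA => ?_
  have hA' := hη.comap_le _ hA
  simp only [Environment.backwardCollisions]
  rw [lintegral_tsum fun n => (Measurable.tsum fun v => hm n v).aemeasurable,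
    lintegral_tsum fun n => (measurable_one.indicator (hcol n)).aemeasurable]
  refine tsum_congr fun n => ?_
  rw [lintegral_tsum fun v => (hm n v).aemeasurable, lintegral_indicator_one (hcol n),
    Measure.restrict_apply (hcol n), measure_eq_tsum_inter (hX.measurable (-(n : ℝ)))
      (hX.ae_ne_infty hη hne _) ((hcol n).inter hA')]
  refine tsum_congr fun v => ?_
  have h := measure_inter_visitEvent hη hX hY hXY (fwd := []) (fwd' := [])
    (bwd := [(-(n : ℝ), v)]) (bwd' := [(-(n : ℝ), v)]) (by simp) (by simp) (by simp) (by simp) hA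
  simp only [Environment.visitProb, one_mul, mul_one] at h
  rw [← h]
  congr 1
  ext ω
  simp only [visitEvent, List.nil_append, List.mem_singleton, forall_eq, mem_inter_iff,
    mem_ofPred_eq, mem_preimage, mem_singleton_iff]
  constructor
  · rintro ⟨hω, h1, h2⟩
    exact ⟨⟨h1.trans h2.symm, hω⟩, h1⟩
  · rintro ⟨⟨h1, hω⟩, h2⟩
    exact ⟨hω, h2, h1.symm.trans h2⟩

/-- Mass transport: the probability that the last collision is at `v` at time `n` is computed by
looking at the environment from `(v, n)`, from where the origin at time zero is at `-v` at time
`-n`. -/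
theorem measure_lastMeetEvent (hη : Measurable η) (hstat : IsStationaryEnv P η)
    (hne : ∀ᵐ ω ∂P, (η ω).NonExplosive) (hX : IsRandomWalkIn P η 0 0 X)
    (hY : IsRandomWalkIn P η 0 0 Y) (hXY : CondIndepGiven P η X Y) (n : ℕ) (v : Fin d → ℤ) :
    P (lastMeetEvent X Y n v) = ∫⁻ ω, (η ω).transProb 0 (-(n : ℝ)) 0 (-v) *
      (η ω).transProb 0 (-(n : ℝ)) 0 (-v) * ⨅ K, (η ω).noMeetProb K 0 0 0 ∂P := by
  have hn : (0 : ℝ) ≤ n := n.cast_nonneg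
  have hF (K : ℕ) : Measurable fun ξ : Environment d =>
      ξ.transProb 0 n 0 v * ξ.transProb 0 n 0 v * ξ.noMeetProb K n v v :=
    ((Environment.measurable_transProb _ _ _ _).mul
      (Environment.measurable_transProb _ _ _ _)).mul (Environment.measurable_noMeetProb _ _ _ _)
  have hshift (ξ : Environment d) (K : ℕ) :
      (ξ.shift v n).transProb 0 n 0 v * (ξ.shift v n).transProb 0 n 0 v *
        (ξ.shift v n).noMeetProb K n v v =
      ξ.transProb 0 (-(n : ℝ)) 0 (-v) * ξ.transProb 0 (-(n : ℝ)) 0 (-v) *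
        ξ.noMeetProb K 0 0 0 := by
    have h1 := ξ.transProb_shift v n (neg_nonpos.mpr hn) (-v) 0
    have h2 := ξ.noMeetProb_shift v n K 0 0 0
    simp only [neg_add_cancel, zero_add] at h1 h2
    rw [h1, h2, Environment.transProb_symm]
  have hK (K : ℕ) : P (visitEvent X [((n : ℝ), v)] ∩ visitEvent Y [((n : ℝ), v)] ∩
      noMeetEvent X Y K n) = ∫⁻ ω, (η ω).transProb 0 (-(n : ℝ)) 0 (-v) *
      (η ω).transProb 0 (-(n : ℝ)) 0 (-v) * (η ω).noMeetProb K 0 0 0 ∂P := by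
    have h := measure_visitEvent_inter_noMeetEvent hη hne hX hY hXY K hn (l := []) (l' := [])
      (by simp) (by simp) (by simp) (by simp) v v
    simp only [List.nil_append, Environment.visitProb, mul_one] at h
    rw [h]
    refine (((hstat v n).comp (hF K)).lintegral_eq.symm.trans ?_)
    exact lintegral_congr fun ω => hshift (η ω) K
  have hle : ∀ᵐ ω ∂P, ∀ v, (η ω).transProb 0 (-(n : ℝ)) 0 v ≤ 1 := by
    filter_upwards [hne] with ω hω v using Environment.transProb_le_one hω _ _ _ _
  have hanti : Antitone fun K => visitEvent X [((n : ℝ), v)] ∩ visitEvent Y [((n : ℝ), v)] ∩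
      noMeetEvent X Y K n :=
    fun K L hKL => inter_subset_inter_right _ fun ω hω i hi => hω i (hi.trans_le hKL)
  rw [lastMeetEvent, hanti.measure_iInter]
  · simp only [hK]
    rw [← lintegral_iInf']
    · refine lintegral_congr_ae ?_
      filter_upwards [hle] with ω hω
      refine (ENNReal.mul_iInf fun h => ?_).symm
      exact absurd h ((mul_le_one' (hω _) (hω _)).trans_lt ENNReal.one_lt_top).ne
    · exact fun K => ((((Environment.measurable_transProb _ _ _ _).mul
        (Environment.measurable_transProb _ _ _ _)).mul
        (Environment.measurable_noMeetProb _ _ _ _)).comp hη).aemeasurable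
    · filter_upwards [hne] with ω hω K L hKL
      exact mul_le_mul_right (Environment.antitone_noMeetProb hω _ _ _ hKL) _
    · rw [← hK]
      exact measure_ne_top _ _
  · exact fun K => (((measurableSet_visitEvent hX.measurable _).inter
      (measurableSet_visitEvent hY.measurable _)).inter
      (measurableSet_noMeetEvent hX.measurable hY.measurable _ _)).nullMeasurableSet
  · exact ⟨0, measure_ne_top _ _⟩

theorem measurableSet_lastMeetEvent (hX : ∀ t, Measurable (X t)) (hY : ∀ t, Measurable (Y t))
    (n : ℕ) (v : Fin d → ℤ) : MeasurableSet (lastMeetEvent X Y n v) :=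
  MeasurableSet.iInter fun _ => ((measurableSet_visitEvent hX _).inter
    (measurableSet_visitEvent hY _)).inter (measurableSet_noMeetEvent hX hY _ _)

theorem tsum_measure_lastMeetEvent_le_one (hX : ∀ t, Measurable (X t))
    (hY : ∀ t, Measurable (Y t)) : ∑' p : ℕ × (Fin d → ℤ), P (lastMeetEvent X Y p.1 p.2) ≤ 1 := by
  rw [← measure_univ (μ := P)]
  refine tsum_measure_le_measure_univ
    (fun p => (measurableSet_lastMeetEvent hX hY _ _).nullMeasurableSet) fun p q hpq => ?_
  refine Disjoint.aedisjoint (Set.disjoint_left.mpr fun ω h1 h2 => hpq ?_)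
  obtain ⟨hX1, hY1, h1⟩ := mem_lastMeetEvent.mp h1
  obtain ⟨hX2, hY2, h2⟩ := mem_lastMeetEvent.mp h2
  have hn : p.1 = q.1 := by
    rcases lt_trichotomy p.1 q.1 with h | h | h
    · exact absurd (hX2.trans hY2.symm) (h1 _ h)
    · exact h
    · exact absurd (hX1.trans hY1.symm) (h2 _ h)
  refine Prod.ext hn (OnePoint.coe_injective ?_)
  rw [← hX1, hn, hX2]

/-- If the expected number of backward collisions is infinite, there is almost surely no last
collision: the probabilities that the last collision is at `v` at time `n` sum, over `v`
and `n`, to the mean of `∞` times the probability of never meeting again, and this sum is at most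
one. -/
theorem measure_lastMeetEvent_eq_zero (hη : Measurable η) (hstat : IsStationaryEnv P η)
    (hne : ∀ᵐ ω ∂P, (η ω).NonExplosive) (hX : IsRandomWalkIn P η 0 0 X)
    (hY : IsRandomWalkIn P η 0 0 Y) (hXY : CondIndepGiven P η X Y)
    (hinf : ∀ᵐ ω ∂P, (η ω).backwardCollisions = ∞) (n : ℕ) (v : Fin d → ℤ) :
    P (lastMeetEvent X Y n v) = 0 := by
  have hmh : Measurable fun ω => ⨅ K, (η ω).noMeetProb K 0 0 0 :=
    Measurable.iInf fun K => (Environment.measurable_noMeetProb K 0 0 0).comp hη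
  have hm (n : ℕ) (v : Fin d → ℤ) : Measurable fun ω => (η ω).transProb 0 (-(n : ℝ)) 0 v *
      (η ω).transProb 0 (-(n : ℝ)) 0 v * ⨅ K, (η ω).noMeetProb K 0 0 0 :=
    (((Environment.measurable_transProb _ _ _ _).mul
      (Environment.measurable_transProb _ _ _ _)).comp hη).mul hmh
  have hsum : ∑' p : ℕ × (Fin d → ℤ), P (lastMeetEvent X Y p.1 p.2) =
      ∫⁻ ω, (η ω).backwardCollisions * ⨅ K, (η ω).noMeetProb K 0 0 0 ∂P := by
    rw [ENNReal.tsum_prod']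
    simp only [Environment.backwardCollisions, ← ENNReal.tsum_mul_right]
    rw [lintegral_tsum fun n => (Measurable.tsum fun v => hm n v).aemeasurable]
    refine tsum_congr fun n => ?_
    rw [lintegral_tsum fun v => (hm n v).aemeasurable, ← (Equiv.neg (Fin d → ℤ)).tsum_eq]
    refine tsum_congr fun v => ?_
    rw [measure_lastMeetEvent hη hstat hne hX hY hXY]
    simp
  have hfin : ∫⁻ ω, (η ω).backwardCollisions * ⨅ K, (η ω).noMeetProb K 0 0 0 ∂P ≠ ∞ := by
    rw [← hsum]
    exact ((tsum_measure_lastMeetEvent_le_one hX.measurable hY.measurable).trans_lt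
      ENNReal.one_lt_top).ne
  have hlt := ae_lt_top ((Environment.measurable_backwardCollisions.comp hη).mul hmh) hfin
  rw [measure_lastMeetEvent hη hstat hne hX hY hXY, lintegral_eq_zero_iff (hm n (-v))]
  filter_upwards [hlt, hinf] with ω h1 h2
  have h0 : ⨅ K, (η ω).noMeetProb K 0 0 0 = 0 := by
    by_contra h
    simp only [Pi.mul_apply, Function.comp_apply, h2, ENNReal.top_mul h] at h1
    exact lt_irrefl _ h1
  simp [h0]

theorem IsRandomWalkIn.ae_eq_start (hX : IsRandomWalkIn P η 0 0 X) (hη : Measurable η) :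
    ∀ᵐ ω ∂P, X 0 ω = ((0 : Fin d → ℤ) : ExtLattice d) := by
  have h := hX.measure_visitEvent hη (fwd := [((0 : ℝ), (0 : Fin d → ℤ))]) (bwd := [])
    (by simp) (by simp)
  simp only [Environment.visitProb, Environment.transProb_self, if_true, mul_one, lintegral_const,
    measure_univ] at h
  have h0 := (prob_compl_eq_zero_iff (measurableSet_visitEvent hX.measurable _)).mpr h
  filter_upwards [compl_mem_ae_iff.mpr h0] with ω hω
  simpa [visitEvent] using hω

end

theorem proposition3p1 {d : ℕ} (hd : 1 ≤ d) {Ω : Type*} [MeasurableSpace Ω] (P : Measure Ω)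
    [IsProbabilityMeasure P] (η : Ω → Environment d) (hη : Measurable η)
    (hstat : IsStationaryEnv P η) (hne : ∀ᵐ ω ∂P, (η ω).NonExplosive)
    (X Y : ℝ → Ω → ExtLattice d)
    (hX : IsRandomWalkIn P η 0 0 X) (hY : IsRandomWalkIn P η 0 0 Y)
    (hXY : CondIndepGiven P η X Y)
    (hinf : ∀ᵐ ω ∂P, condLExp (MeasurableSpace.comap η inferInstance) P
      (fun ω' => ∑' n : ℕ, {ω'' | X (-(n : ℝ)) ω'' = Y (-(n : ℝ)) ω''}.indicator 1 ω') ω = ∞) :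
    ∀ᵐ ω ∂P, ∑' n : ℕ, {ω' | X (n : ℝ) ω' = Y (n : ℝ) ω'}.indicator (1 : Ω → ℝ≥0∞) ω = ∞ := by
  have hback : ∀ᵐ ω ∂P, (η ω).backwardCollisions = ∞ := by
    filter_upwards [condLExp_collisions hη hne hX hY hXY, hinf] with ω h1 h2
    exact h1.trans h2
  have hlast : ∀ᵐ ω ∂P, ∀ (n : ℕ) (v : Fin d → ℤ), ω ∉ lastMeetEvent X Y n v :=
    ae_all_iff.mpr fun n => ae_all_iff.mpr fun v => measure_eq_zero_iff_ae_notMem.mp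
      (measure_lastMeetEvent_eq_zero hη hstat hne hX hY hXY hback n v)
  have hfinite : ∀ᵐ ω ∂P, ∀ n : ℕ, X n ω ≠ OnePoint.infty :=
    ae_all_iff.mpr fun n => hX.ae_ne_infty hη hne n
  -- The walks meet at time zero, so finitely many collisions would include a last one.
  filter_upwards [hlast, hfinite, hX.ae_eq_start hη, hY.ae_eq_start hη] with ω h1 h2 h3 h4
  have hC : {n : ℕ | X (n : ℝ) ω = Y (n : ℝ) ω}.Infinite := by
    intro hfin
    obtain ⟨n, hn, hmax⟩ := hfin.exists_maximal ⟨0, by simp [h3, h4]⟩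
    obtain ⟨v, hv⟩ := OnePoint.ne_infty_iff_exists.mp (h2 n)
    refine h1 n v (mem_lastMeetEvent.mpr ⟨hv.symm, ?_, fun m hm heq => ?_⟩)
    · rw [hv]
      exact hn.symm
    · exact absurd (hmax heq hm.le) hm.not_ge
  have hsum : ∑' n : ℕ, {ω' | X (n : ℝ) ω' = Y (n : ℝ) ω'}.indicator (1 : Ω → ℝ≥0∞) ω =
      ∑' _ : {n : ℕ | X (n : ℝ) ω = Y (n : ℝ) ω}, (1 : ℝ≥0∞) := by
    rw [tsum_subtype {n : ℕ | X (n : ℝ) ω = Y (n : ℝ) ω} fun _ => (1 : ℝ≥0∞)]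
    rfl
  rw [hsum, ENNReal.tsum_set_one, hC.encard_eq]
  rfl
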